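/- Let $\Bbbk$ be a field with $\operatorname{char}\Bbbk\neq 2$, and let $\mathcal B$ be the super Jordan plane, i.e. the $\Bbbk$-algebra presented by generators $x,y$ with relations $x^2=0$ and $yz-zy-xz=0$, where $z=xy+yx$. It is graded by $\mathbb N_0$ with $x,y$ in degree $1$, $\mathcal B=\bigoplus_{n\ge 0}\mathcal B_n$, and is a superalgebra with even part $\bigoplus_{n \text{ even}}\mathcal B_n$ and odd part $\bigoplus_{n\text{ odd}}\mathcal B_n$. Let $g$ be the algebra automorphism of $\mathcal B$ with $g\cdot x=-x$ and $g\cdot y=-y+x$, and let $c$ be the braiding of $\mathcal B$ given by $c(a\otimes b)=(g^n\cdot b)\otimes a$ for $a\in\mathcal B_n$, $b\in\mathcal B$. Then $\mathcal B$ is a braided Hopf algebra: its comultiplication $\Delta$ is the algebra map from $\mathcal B$ to $\mathcal B\otimes\mathcal B$, the latter with the multiplication $(m\otimes m)(\mathrm{id}\otimes c\otimes\mathrm{id})$, for which $x$ and $y$ are primitive; its counit $\varepsilon$ is the algebra map with $\varepsilon(x)=\varepsilon(y)=0$. Let $\operatorname{Aut}_{\mathrm{Hopf}}(\mathcal B)$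 be the group of braided Hopf algebra automorphisms of $\mathcal B$, that is, of the algebra automorphisms of $\mathcal B$ that commute with $\Delta$, $\varepsilon$ and $c$, and let $\operatorname{Aut}_{\mathrm{super}}(\mathcal B)$ be the group of algebra automorphisms that preserve the even and the odd part. For $s\in\Bbbk$ and $\mu\in\Bbbk^\times$ let $\sigma_{s,\mu}$ be the algebra automorphism of $\mathcal B$ with $\sigma_{s,\mu}(x)=\mu x$ and $\sigma_{s,\mu}(y)=\mu y+sx$, and let $G=\{\sigma_{s,\mu}:\mu\in\Bbbk^\times,\ s\in\Bbbk\}$, a subgroup of the group of algebra automorphisms of $\mathcal B$. Then $$\operatorname{Aut}_{\mathrm{Hopf}}(\mathcal B)\cap\operatorname{Aut}_{\mathrm{super}}(\mathcal B)=G .$$ If moreover $\operatorname{char}\Bbbk=0$, then $\operatorname{Aut}_{\mathrm{Hopf}}(\mathcal B)=G$. -/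

import Mathlib

open scoped TensorProduct DirectSum

noncomputable section

namespace SuperJordan

/-! ### The braiding and the braided tensor square of a graded algebra with an automorphism

Let `B` be an algebra graded by `ℕ` with an algebra endomorphism `g`. Seen over the group algebra
of an infinite cyclic group with generator `g`, where an element `a` of degree `n` has coaction
`g ^ n ⊗ a`, the Yetter-Drinfeld braiding of `B` is `c (a ⊗ b) = (g ^ n • b) ⊗ a`. -/

section Braided

variable {k B : Type*} [Field k] [Ring B] [Algebra k B]
variable (𝒜 : ℕ → Submodule k B) [GradedAlgebra 𝒜] (g : B →ₐ[k] B)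

/-- The linear map `a ↦ (b ↦ (g ^ n) b ⊗ a)` for `a` homogeneous of degree `n`. -/
def braidingComponent (n : ℕ) : 𝒜 n →ₗ[k] B →ₗ[k] B ⊗[k] B :=
  ((TensorProduct.mk k B B).flip.compl₂ (g ^ n).toLinearMap).comp (𝒜 n).subtype

/-- The braiding `c : B ⊗ B → B ⊗ B`, `c (a ⊗ b) = (g ^ n) b ⊗ a` for `a` of degree `n`. -/
def braiding : B ⊗[k] B →ₗ[k] B ⊗[k] B :=
  TensorProduct.lift
    ((DirectSum.toModule k ℕ (B →ₗ[k] B ⊗[k] B) (braidingComponent 𝒜 g)).comp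
      (DirectSum.decomposeLinearEquiv 𝒜).toLinearMap)

theorem braiding_tmul {n : ℕ} {a : B} (ha : a ∈ 𝒜 n) (b : B) :
    braiding 𝒜 g (a ⊗ₜ[k] b) = (g ^ n) b ⊗ₜ[k] a := by
  lift a to 𝒜 n using ha
  simp only [braiding, TensorProduct.lift.tmul, LinearMap.comp_apply, LinearEquiv.coe_coe,
    DirectSum.decomposeLinearEquiv_apply, DirectSum.decompose_coe]
  rw [← DirectSum.lof_eq_of k, DirectSum.toModule_lof]
  rfl

/-- The space `B ⊗ B`, to be equipped with the multiplication `(m ⊗ m) (id ⊗ c ⊗ id)`. -/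
@[nolint unusedArguments]
def BraidedTensor (_𝒜 : ℕ → Submodule k B) (_g : B →ₐ[k] B) : Type _ := B ⊗[k] B

instance : AddCommGroup (BraidedTensor 𝒜 g) := inferInstanceAs (AddCommGroup (B ⊗[k] B))
instance : Module k (BraidedTensor 𝒜 g) := inferInstanceAs (Module k (B ⊗[k] B))

/-- The identity map from `B ⊗ B` to the braided tensor square. -/
def toBraided : B ⊗[k] B ≃ₗ[k] BraidedTensor 𝒜 g := LinearEquiv.refl k _

/-- The map `id ⊗ c ⊗ id` on `B ⊗ B ⊗ B ⊗ B`, with the parentheses `(B ⊗ B) ⊗ (B ⊗ B)`. -/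
def middleBraiding : (B ⊗[k] B) ⊗[k] (B ⊗[k] B) →ₗ[k] (B ⊗[k] B) ⊗[k] (B ⊗[k] B) :=
  (TensorProduct.assoc k B B (B ⊗[k] B)).symm.toLinearMap ∘ₗ
    LinearMap.lTensor B
      ((TensorProduct.assoc k B B B).toLinearMap ∘ₗ
        LinearMap.rTensor B (braiding 𝒜 g) ∘ₗ
        (TensorProduct.assoc k B B B).symm.toLinearMap) ∘ₗ
    (TensorProduct.assoc k B B (B ⊗[k] B)).toLinearMap

/-- The multiplication `(m ⊗ m) (id ⊗ c ⊗ id)` of the braided tensor square. -/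
def braidedMul : (B ⊗[k] B) ⊗[k] (B ⊗[k] B) →ₗ[k] B ⊗[k] B :=
  TensorProduct.map (LinearMap.mul' k B) (LinearMap.mul' k B) ∘ₗ middleBraiding 𝒜 g

instance : Mul (BraidedTensor 𝒜 g) where
  mul u v := toBraided 𝒜 g
    (braidedMul 𝒜 g ((toBraided 𝒜 g).symm u ⊗ₜ[k] (toBraided 𝒜 g).symm v))

instance : One (BraidedTensor 𝒜 g) where
  one := toBraided 𝒜 g (1 ⊗ₜ[k] 1)

theorem mul_tmul (a a' b' : B) {n : ℕ} {b : B} (hb : b ∈ 𝒜 n) :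
    toBraided 𝒜 g (a ⊗ₜ[k] b) * toBraided 𝒜 g (a' ⊗ₜ[k] b') =
      toBraided 𝒜 g ((a * (g ^ n) a') ⊗ₜ[k] (b * b')) := by
  change toBraided 𝒜 g (braidedMul 𝒜 g ((a ⊗ₜ[k] b) ⊗ₜ[k] (a' ⊗ₜ[k] b'))) = _
  simp [braidedMul, middleBraiding, braiding_tmul 𝒜 g hb]

protected theorem mul_add' (u v w : BraidedTensor 𝒜 g) : u * (v + w) = u * v + u * w := by
  change toBraided 𝒜 g (braidedMul 𝒜 g _) = toBraided 𝒜 g (braidedMul 𝒜 g _) +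
    toBraided 𝒜 g (braidedMul 𝒜 g _)
  rw [← map_add, ← map_add, ← TensorProduct.tmul_add, ← map_add]

protected theorem add_mul' (u v w : BraidedTensor 𝒜 g) : (u + v) * w = u * w + v * w := by
  change toBraided 𝒜 g (braidedMul 𝒜 g _) = toBraided 𝒜 g (braidedMul 𝒜 g _) +
    toBraided 𝒜 g (braidedMul 𝒜 g _)
  rw [← map_add, ← map_add, ← TensorProduct.add_tmul, ← map_add]

protected theorem smul_mul' (r : k) (u v : BraidedTensor 𝒜 g) : (r • u) * v = r • (u * v) := by
  change toBraided 𝒜 g (braidedMul 𝒜 g _) = r • toBraided 𝒜 g (braidedMul 𝒜 g _)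
  rw [← map_smul, ← map_smul, TensorProduct.smul_tmul', ← map_smul]

protected theorem mul_smul' (r : k) (u v : BraidedTensor 𝒜 g) : u * (r • v) = r • (u * v) := by
  change toBraided 𝒜 g (braidedMul 𝒜 g _) = r • toBraided 𝒜 g (braidedMul 𝒜 g _)
  rw [← map_smul, ← map_smul, ← TensorProduct.tmul_smul, ← map_smul]

variable {𝒜 g} in
theorem BraidedTensor.induction {P : BraidedTensor 𝒜 g → Prop} (h0 : P 0)
    (hadd : ∀ u v, P u → P v → P (u + v))
    (ht : ∀ (a b : B) (n : ℕ), b ∈ 𝒜 n → P (toBraided 𝒜 g (a ⊗ₜ[k] b)))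
    (u : BraidedTensor 𝒜 g) : P u := by
  obtain ⟨u, rfl⟩ := (toBraided 𝒜 g).surjective u
  induction u using TensorProduct.induction_on with
  | zero => simpa using h0
  | add u v hu hv => rw [map_add]; exact hadd _ _ hu hv
  | tmul a b =>
    induction b using DirectSum.Decomposition.inductionOn 𝒜 with
    | zero => simpa using h0
    | @homogeneous i m => exact ht a m i m.2
    | add m m' hm hm' => rw [TensorProduct.tmul_add, map_add]; exact hadd _ _ hm hm'

instance : Ring (BraidedTensor 𝒜 g) :=
  { (inferInstance : AddCommGroup (BraidedTensor 𝒜 g)),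
    (inferInstance : Mul (BraidedTensor 𝒜 g)),
    (inferInstance : One (BraidedTensor 𝒜 g)) with
    left_distrib := SuperJordan.mul_add' 𝒜 g
    right_distrib := SuperJordan.add_mul' 𝒜 g
    zero_mul := fun u => by simpa using SuperJordan.smul_mul' 𝒜 g 0 0 u
    mul_zero := fun u => by simpa using SuperJordan.mul_smul' 𝒜 g 0 u 0
    mul_assoc := fun u v w => by
      induction u using BraidedTensor.induction with
      | h0 =>
        have h (t : BraidedTensor 𝒜 g) : 0 * t = 0 := by
          simpa using SuperJordan.smul_mul' 𝒜 g 0 0 t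
        rw [h, h, h]
      | hadd u u' hu hu' => simp only [SuperJordan.add_mul', hu, hu']
      | ht a b n hb =>
        induction v using BraidedTensor.induction with
        | h0 =>
          have h (t : BraidedTensor 𝒜 g) : 0 * t = 0 := by
            simpa using SuperJordan.smul_mul' 𝒜 g 0 0 t
          have h' (t : BraidedTensor 𝒜 g) : t * 0 = 0 := by
            simpa using SuperJordan.mul_smul' 𝒜 g 0 t 0
          rw [h, h', h]
        | hadd v v' hv hv' => simp only [SuperJordan.add_mul', SuperJordan.mul_add', hv, hv']
        | ht a' b' m hb' =>
          induction w using BraidedTensor.induction with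
          | h0 =>
            have h' (t : BraidedTensor 𝒜 g) : t * 0 = 0 := by
              simpa using SuperJordan.mul_smul' 𝒜 g 0 t 0
            rw [h', h', h']
          | hadd w w' hw hw' => simp only [SuperJordan.mul_add', hw, hw']
          | ht a'' b'' l hb'' =>
            rw [mul_tmul 𝒜 g _ _ _ hb, mul_tmul 𝒜 g _ _ _ hb', mul_tmul 𝒜 g _ _ _ hb,
              mul_tmul 𝒜 g _ _ _ (SetLike.mul_mem_graded hb hb')]
            simp [pow_add, mul_assoc]
    one_mul := fun u => by
      induction u using BraidedTensor.induction with
      | h0 => simpa using SuperJordan.mul_smul' 𝒜 g 0 1 0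
      | hadd u u' hu hu' => rw [SuperJordan.mul_add', hu, hu']
      | ht a b n hb =>
        change toBraided 𝒜 g (1 ⊗ₜ[k] 1) * _ = _
        rw [mul_tmul 𝒜 g _ _ _ (SetLike.one_mem_graded 𝒜)]; simp
    mul_one := fun u => by
      induction u using BraidedTensor.induction with
      | h0 => simpa using SuperJordan.smul_mul' 𝒜 g 0 0 1
      | hadd u u' hu hu' => rw [SuperJordan.add_mul', hu, hu']
      | ht a b n hb => change _ * toBraided 𝒜 g (1 ⊗ₜ[k] 1) = _; rw [mul_tmul 𝒜 g _ _ _ hb]; simp }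

instance : Algebra k (BraidedTensor 𝒜 g) :=
  Algebra.ofModule (SuperJordan.smul_mul' 𝒜 g) (SuperJordan.mul_smul' 𝒜 g)

end Braided

/-! ### The super Jordan plane -/

/-- The two generators. -/
inductive Gen
  | x
  | y

section Plane

variable (k : Type*) [Field k]

/-- The element `z = x y + y x` attached to two elements of a ring. -/
def zOf {R : Type*} [Ring R] (x y : R) : R := x * y + y * x

/-- The defining relations `x ^ 2 = 0` and `y z - z y - x z = 0`. -/
inductive Rel : FreeAlgebra k Gen → FreeAlgebra k Gen → Prop
  | sq : Rel (FreeAlgebra.ι k Gen.x ^ 2) 0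
  | cubic : Rel
      (FreeAlgebra.ι k Gen.y * zOf (FreeAlgebra.ι k Gen.x) (FreeAlgebra.ι k Gen.y)
        - zOf (FreeAlgebra.ι k Gen.x) (FreeAlgebra.ι k Gen.y) * FreeAlgebra.ι k Gen.y
        - FreeAlgebra.ι k Gen.x * zOf (FreeAlgebra.ι k Gen.x) (FreeAlgebra.ι k Gen.y)) 0

/-- The super Jordan plane, presented by generators and relations. -/
def Plane : Type _ := RingQuot (Rel k)

instance : Ring (Plane k) := inferInstanceAs (Ring (RingQuot (Rel k)))
instance : Algebra k (Plane k) := inferInstanceAs (Algebra k (RingQuot (Rel k)))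

/-- The class of a generator. -/
def gen (i : Gen) : Plane k := RingQuot.mkAlgHom k (Rel k) (FreeAlgebra.ι k i)

/-- The generator `x`. -/
def X : Plane k := gen k Gen.x

/-- The generator `y`. -/
def Y : Plane k := gen k Gen.y

/-- The element `z = x y + y x`. -/
def Z : Plane k := zOf (X k) (Y k)

theorem X_sq : X k ^ 2 = 0 := by
  have h := RingQuot.mkAlgHom_rel k (Rel.sq (k := k))
  rw [map_pow, map_zero] at h
  exact h

theorem X_mul_X : X k * X k = 0 := by rw [← sq, X_sq]

theorem cubic : Y k * Z k - Z k * Y k - X k * Z k = 0 := by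
  have h := RingQuot.mkAlgHom_rel k (Rel.cubic (k := k))
  simp only [zOf, map_sub, map_mul, map_add, map_zero] at h
  exact h

variable {k}

/-- The algebra map out of the super Jordan plane given by two elements that satisfy the defining
relations. -/
def lift {R : Type*} [Ring R] [Algebra k R] (x y : R) (h₁ : x ^ 2 = 0)
    (h₂ : y * zOf x y - zOf x y * y - x * zOf x y = 0) : Plane k →ₐ[k] R :=
  RingQuot.liftAlgHom k
    ⟨FreeAlgebra.lift k (fun i => match i with | Gen.x => x | Gen.y => y), by
      intro a b hab
      cases hab with
      | sq => simpa using h₁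
      | cubic => simpa [zOf] using h₂⟩

section lift

variable {R : Type*} [Ring R] [Algebra k R] {x y : R} (h₁ : x ^ 2 = 0)
  (h₂ : y * zOf x y - zOf x y * y - x * zOf x y = 0)

@[simp] theorem lift_X : lift (k := k) x y h₁ h₂ (X k) = x := by
  refine (RingQuot.liftAlgHom_mkAlgHom_apply k _ _ _).trans ?_
  simp

@[simp] theorem lift_Y : lift (k := k) x y h₁ h₂ (Y k) = y := by
  refine (RingQuot.liftAlgHom_mkAlgHom_apply k _ _ _).trans ?_
  simp

theorem hom_ext {f f' : Plane k →ₐ[k] R} (hx : f (X k) = f' (X k)) (hy : f (Y k) = f' (Y k)) :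
    f = f' := by
  refine RingQuot.ringQuot_ext' k f f' ?_
  ext i
  cases i
  · exact hx
  · exact hy

end lift

variable (k)

/-! ### The grading -/

/-- The braided vector space `V`, spanned by `x` and `y`. -/
def V : Submodule k (Plane k) := Submodule.span k {X k, Y k}

/-- The homogeneous component of degree `n`: the span of the monomials of length `n`. -/
def homog (n : ℕ) : Submodule k (Plane k) := V k ^ n

theorem X_mem_V : X k ∈ V k := Submodule.subset_span (by simp)
theorem Y_mem_V : Y k ∈ V k := Submodule.subset_span (by simp)
theorem X_mem : X k ∈ homog k 1 := by rw [homog, pow_one]; exact X_mem_V k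
theorem Y_mem : Y k ∈ homog k 1 := by rw [homog, pow_one]; exact Y_mem_V k

instance : SetLike.GradedMonoid (homog k) :=
  inferInstanceAs (SetLike.GradedMonoid (fun n : ℕ => V k ^ n))

theorem Z_mem : Z k ∈ homog k 2 :=
  add_mem (SetLike.mul_mem_graded (X_mem k) (Y_mem k))
    (SetLike.mul_mem_graded (Y_mem k) (X_mem k))

/-- A homogeneous element, placed in the direct sum of the homogeneous components. -/
def ofHomog {n : ℕ} {a : Plane k} (ha : a ∈ homog k n) : ⨁ n, homog k n :=
  DirectSum.of (fun n => homog k n) n ⟨a, ha⟩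

theorem ofHomog_mul {m n : ℕ} {a b : Plane k} (ha : a ∈ homog k m) (hb : b ∈ homog k n) :
    ofHomog k ha * ofHomog k hb = ofHomog k (SetLike.mul_mem_graded ha hb) := by
  rw [ofHomog, ofHomog, DirectSum.of_mul_of]; rfl

theorem ofHomog_add {n : ℕ} {a b : Plane k} (ha : a ∈ homog k n) (hb : b ∈ homog k n) :
    ofHomog k ha + ofHomog k hb = ofHomog k (add_mem ha hb) := by
  rw [ofHomog, ofHomog, ← map_add]; rfl

theorem ofHomog_sub {n : ℕ} {a b : Plane k} (ha : a ∈ homog k n) (hb : b ∈ homog k n) :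
    ofHomog k ha - ofHomog k hb = ofHomog k (sub_mem ha hb) := by
  exact (map_sub (DirectSum.of (fun n => homog k n) n) ⟨a, ha⟩ ⟨b, hb⟩).symm

theorem ofHomog_eq_zero {n : ℕ} {a : Plane k} (ha : a ∈ homog k n) (h : a = 0) :
    ofHomog k ha = 0 := by
  subst h; exact map_zero _

/-- The decomposition into homogeneous components. -/
def decomposeHom : Plane k →ₐ[k] ⨁ n, homog k n :=
  lift (ofHomog k (X_mem k)) (ofHomog k (Y_mem k))
    (by rw [sq, ofHomog_mul]; exact ofHomog_eq_zero k _ (X_mul_X k))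
    (by
      have hz : zOf (ofHomog k (X_mem k)) (ofHomog k (Y_mem k)) = ofHomog k (Z_mem k) := by
        rw [zOf, ofHomog_mul, ofHomog_mul]
        exact ofHomog_add k (n := 2) _ _
      rw [hz, ofHomog_mul, ofHomog_mul, ofHomog_mul]
      refine Eq.trans (congrArg₂ _ (ofHomog_sub k (n := 3) _ _) rfl) ?_
      exact (ofHomog_sub k (n := 3) _ _).trans (ofHomog_eq_zero k _ (cubic k)))

/-- The super Jordan plane is graded by `ℕ`, with `x` and `y` in degree `1`. -/
instance : GradedAlgebra (homog k) :=
  GradedAlgebra.ofAlgHom (homog k) (decomposeHom k)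
    (by
      apply hom_ext
      · simp [decomposeHom, ofHomog]
      · simp [decomposeHom, ofHomog])
    (fun n a => by
      obtain ⟨a, ha⟩ := a
      dsimp only
      induction ha using Submodule.pow_induction_on_left' with
      | algebraMap r =>
        rw [AlgHom.commutes, DirectSum.algebraMap_apply]; rfl
      | add a b n ha hb iha ihb =>
        rw [map_add, iha, ihb, ← map_add]; rfl
      | mem_mul m hm n a ha ih =>
        have hm1 : m ∈ homog k 1 := by rw [homog, pow_one]; exact hm
        have key : decomposeHom k m = ofHomog k hm1 := by
          clear ih
          revert hm1
          rw [V] at hm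
          induction hm using Submodule.span_induction with
          | mem u hu =>
            intro _
            rcases hu with rfl | rfl
            · exact lift_X _ _
            · exact lift_Y _ _
          | zero => intro h; rw [map_zero]; exact (ofHomog_eq_zero k h rfl).symm
          | add u v hu hv ihu ihv =>
            intro h
            have hu' : u ∈ homog k 1 := by rw [homog, pow_one]; exact hu
            have hv' : v ∈ homog k 1 := by rw [homog, pow_one]; exact hv
            rw [map_add, ihu hu', ihv hv', ofHomog_add]
          | smul r u hu ihu =>
            intro h
            have hu' : u ∈ homog k 1 := by rw [homog, pow_one]; exact hu
            rw [map_smul, ihu hu', ofHomog, ofHomog, ← DirectSum.lof_eq_of k,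
              ← DirectSum.lof_eq_of k, ← map_smul]
            rfl
        rw [map_mul, ih, key, ofHomog, DirectSum.of_mul_of]
        exact DirectSum.of_eq_of_gradedMonoid_eq (Sigma.subtype_ext (add_comm _ _) rfl))

/-- The even part `B₀` for `i = 0` and the odd part `B₁` for `i = 1`. -/
def superPart (i : ZMod 2) : Submodule k (Plane k) :=
  ⨆ (n : ℕ) (_ : (n : ZMod 2) = i), homog k n

/-! ### The braided Hopf algebra structure -/

theorem zOf_action : zOf (-X k) (-Y k + X k) = Z k := by
  have h := X_mul_X k
  simp only [zOf, Z, mul_add, add_mul, neg_mul, mul_neg, neg_neg, h]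
  abel

/-- The action of the generator `g` of the infinite cyclic group: the algebra map with
`g x = -x` and `g y = -y + x`. -/
def action : Plane k →ₐ[k] Plane k :=
  lift (-X k) (-Y k + X k) (by rw [neg_sq, X_sq]) (by
    rw [zOf_action]
    have h := cubic k
    have h' : X k * Z k = Z k * X k := by
      simp only [Z, zOf, mul_add, add_mul, mul_assoc, X_mul_X]
      simp only [← mul_assoc, X_mul_X]
      simp
    have : (-Y k + X k) * Z k - Z k * (-Y k + X k) - -X k * Z k =
        -(Y k * Z k - Z k * Y k - X k * Z k) + (X k * Z k - Z k * X k) := by noncomm_ring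
    rw [this, h, h']; simp)

/-- The braiding `c` of the super Jordan plane. -/
abbrev c : Plane k ⊗[k] Plane k →ₗ[k] Plane k ⊗[k] Plane k := braiding (homog k) (action k)

/-- The braided tensor square of the super Jordan plane. -/
abbrev Square : Type _ := BraidedTensor (homog k) (action k)

/-- The pure tensor `a ⊗ b`, in the braided tensor square. -/
def pureTensor (a b : Plane k) : Square k := toBraided (homog k) (action k) (a ⊗ₜ[k] b)

/-- The element `a ⊗ 1 + 1 ⊗ a` of the braided tensor square. -/
def prim (a : Plane k) : Square k := pureTensor k a 1 + pureTensor k 1 a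

@[simp] theorem action_X : action k (X k) = -X k := lift_X _ _
@[simp] theorem action_Y : action k (Y k) = -Y k + X k := lift_Y _ _
@[simp] theorem action_Z : action k (Z k) = Z k := by
  refine Eq.trans ?_ (zOf_action k)
  rw [Z, zOf, zOf, map_add, map_mul, map_mul, action_X, action_Y]

theorem pureTensor_mul {n : ℕ} (a a' b' : Plane k) {b : Plane k} (hb : b ∈ homog k n) :
    pureTensor k a b * pureTensor k a' b' = pureTensor k (a * (action k ^ n) a') (b * b') :=
  mul_tmul _ _ _ _ _ hb

theorem one_mul_pureTensor (a a' b' : Plane k) : pureTensor k a 1 * pureTensor k a' b' = pureTensor k (a * a') b' := by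
  rw [pureTensor_mul k a a' b' (SetLike.one_mem_graded (homog k))]; simp

theorem X_mul_pureTensor (a a' b' : Plane k) :
    pureTensor k a (X k) * pureTensor k a' b' = pureTensor k (a * action k a') (X k * b') := by
  rw [pureTensor_mul k a a' b' (X_mem k), pow_one]

theorem Y_mul_pureTensor (a a' b' : Plane k) :
    pureTensor k a (Y k) * pureTensor k a' b' = pureTensor k (a * action k a') (Y k * b') := by
  rw [pureTensor_mul k a a' b' (Y_mem k), pow_one]

theorem Z_mul_pureTensor (a a' b' : Plane k) :
    pureTensor k a (Z k) * pureTensor k a' b' = pureTensor k (a * action k (action k a')) (Z k * b') := by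
  rw [pureTensor_mul k a a' b' (Z_mem k), sq]; rfl

theorem pureTensor_add_left (a a' b : Plane k) : pureTensor k (a + a') b = pureTensor k a b + pureTensor k a' b := by
  simp [pureTensor, TensorProduct.add_tmul]
theorem pureTensor_add_right (a b b' : Plane k) : pureTensor k a (b + b') = pureTensor k a b + pureTensor k a b' := by
  simp [pureTensor, TensorProduct.tmul_add]
theorem pureTensor_neg_left (a b : Plane k) : pureTensor k (-a) b = -pureTensor k a b := by
  simp [pureTensor, TensorProduct.neg_tmul]
theorem pureTensor_neg_right (a b : Plane k) : pureTensor k a (-b) = -pureTensor k a b := by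
  simp [pureTensor, TensorProduct.tmul_neg]
theorem pureTensor_zero_left (b : Plane k) : pureTensor k 0 b = 0 := by simp [pureTensor]
theorem pureTensor_zero_right (a : Plane k) : pureTensor k a 0 = 0 := by simp [pureTensor]

theorem prim_X_sq : prim k (X k) ^ 2 = 0 := by
  rw [sq, prim]
  simp only [mul_add, add_mul, one_mul_pureTensor, X_mul_pureTensor, mul_one, one_mul, action_X, map_one,
    pureTensor_neg_left, X_mul_X, pureTensor_zero_left, pureTensor_zero_right]
  abel

theorem zOf_prim : zOf (prim k (X k)) (prim k (Y k)) =
    pureTensor k (Z k) 1 + pureTensor k 1 (Z k) + pureTensor k (X k) (X k) := by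
  simp only [zOf, prim, Z, mul_add, add_mul, one_mul_pureTensor, X_mul_pureTensor, Y_mul_pureTensor, mul_one,
    one_mul, action_X, action_Y, map_one, pureTensor_neg_left, pureTensor_add_left, pureTensor_add_right]
  abel

theorem prim_cubic : prim k (Y k) * zOf (prim k (X k)) (prim k (Y k))
    - zOf (prim k (X k)) (prim k (Y k)) * prim k (Y k)
    - prim k (X k) * zOf (prim k (X k)) (prim k (Y k)) = 0 := by
  have h : Y k * Z k = Z k * Y k + X k * Z k := by
    have := cubic k
    rwa [sub_sub, sub_eq_zero] at this
  have h₁ : Y k * X k = Z k - X k * Y k := by rw [Z, zOf]; abel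
  rw [zOf_prim]
  simp only [prim, mul_add, add_mul, one_mul_pureTensor, X_mul_pureTensor, Y_mul_pureTensor, Z_mul_pureTensor, mul_one,
    one_mul, action_X, action_Y, action_Z, map_one, map_add, map_neg, h, h₁, sub_eq_add_neg,
    pureTensor_neg_left, pureTensor_neg_right, pureTensor_add_left, pureTensor_add_right, mul_neg, neg_neg,
    X_mul_X, pureTensor_zero_left, pureTensor_zero_right]
  abel

/-- The comultiplication as an algebra map to the braided tensor square: the algebra map for which
`x` and `y` are primitive. -/
def comulHom : Plane k →ₐ[k] Square k :=
  lift (prim k (X k)) (prim k (Y k)) (prim_X_sq k) (prim_cubic k)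

/-- The comultiplication `Δ : B → B ⊗ B`. -/
def comul : Plane k →ₗ[k] Plane k ⊗[k] Plane k :=
  (toBraided (homog k) (action k)).symm.toLinearMap ∘ₗ (comulHom k).toLinearMap

/-- The counit `ε : B → k`, the algebra map that vanishes on `x` and `y`. -/
def counit : Plane k →ₐ[k] k := lift 0 0 (by simp) (by simp)

/-! ### The groups of automorphisms -/

/-- The group of automorphisms of the braided Hopf algebra `B`: the algebra automorphisms that
commute with the comultiplication, the counit and the braiding. -/
def autHopf : Subgroup (Plane k ≃ₐ[k] Plane k) where
  carrier := {σ |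
    (∀ a, comul k (σ a) = TensorProduct.map σ.toLinearMap σ.toLinearMap (comul k a)) ∧
    (∀ a, counit k (σ a) = counit k a) ∧
    (∀ u, c k (TensorProduct.map σ.toLinearMap σ.toLinearMap u) =
      TensorProduct.map σ.toLinearMap σ.toLinearMap (c k u))}
  one_mem' := by
    have h : TensorProduct.map (1 : Plane k ≃ₐ[k] Plane k).toLinearMap
        (1 : Plane k ≃ₐ[k] Plane k).toLinearMap = LinearMap.id := TensorProduct.map_id
    exact ⟨fun a => by rw [h]; rfl, fun a => rfl, fun u => by rw [h]; rfl⟩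
  mul_mem' := by
    rintro σ τ ⟨h₁, h₂, h₃⟩ ⟨h₁', h₂', h₃'⟩
    have h (u) : TensorProduct.map (σ * τ).toLinearMap (σ * τ).toLinearMap u =
        TensorProduct.map σ.toLinearMap σ.toLinearMap
          (TensorProduct.map τ.toLinearMap τ.toLinearMap u) :=
      LinearMap.congr_fun
        (TensorProduct.map_comp σ.toLinearMap σ.toLinearMap τ.toLinearMap τ.toLinearMap) u
    refine ⟨fun a => ?_, fun a => ?_, fun u => ?_⟩
    · rw [h, ← h₁', ← h₁]; rfl
    · rw [AlgEquiv.mul_apply, h₂, h₂']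
    · rw [h, h₃, h₃', h]
  inv_mem' := by
    rintro σ ⟨h₁, h₂, h₃⟩
    have h (u) : TensorProduct.map (σ⁻¹).toLinearMap (σ⁻¹).toLinearMap
        (TensorProduct.map σ.toLinearMap σ.toLinearMap u) = u := by
      rw [← LinearMap.comp_apply, ← TensorProduct.map_comp]
      have : (σ⁻¹).toLinearMap ∘ₗ σ.toLinearMap = LinearMap.id :=
        LinearMap.ext fun a => σ.symm_apply_apply a
      rw [this, TensorProduct.map_id]; rfl
    have h' (u) : TensorProduct.map σ.toLinearMap σ.toLinearMap
        (TensorProduct.map (σ⁻¹).toLinearMap (σ⁻¹).toLinearMap u) = u := by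
      rw [← LinearMap.comp_apply, ← TensorProduct.map_comp]
      have : σ.toLinearMap ∘ₗ (σ⁻¹).toLinearMap = LinearMap.id :=
        LinearMap.ext fun a => σ.apply_symm_apply a
      rw [this, TensorProduct.map_id]; rfl
    have e (a) : σ (σ⁻¹ a) = a := σ.apply_symm_apply a
    refine ⟨fun a => ?_, fun a => ?_, fun u => ?_⟩
    · rw [← h (comul k (σ⁻¹ a)), ← h₁, e]
    · rw [← h₂ (σ⁻¹ a), e]
    · rw [← h (c k _), ← h₃, h']

/-- The group of automorphisms of the superalgebra `B`: the algebra automorphisms that preserve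
`B₀` and `B₁`. -/
def autSuper : Subgroup (Plane k ≃ₐ[k] Plane k) where
  carrier := {σ | ∀ i : ZMod 2, (superPart k i).map σ.toLinearMap = superPart k i}
  one_mem' := fun i => Submodule.map_id _
  mul_mem' := by
    intro σ τ h h' i
    have : (superPart k i).map (σ * τ).toLinearMap =
        ((superPart k i).map τ.toLinearMap).map σ.toLinearMap :=
      Submodule.map_comp τ.toLinearMap σ.toLinearMap _
    rw [this, h', h]
  inv_mem' := by
    intro σ h i
    have e : (σ⁻¹).toLinearMap ∘ₗ σ.toLinearMap = LinearMap.id :=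
      LinearMap.ext fun a => σ.symm_apply_apply a
    conv_lhs => rw [← h i]
    rw [← Submodule.map_comp, e, Submodule.map_id]

/-- The algebra endomorphism with `x ↦ μ x` and `y ↦ μ y + s x`. -/
def sigmaHom (s μ : k) : Plane k →ₐ[k] Plane k :=
  lift (μ • X k) (μ • Y k + s • X k) (by rw [smul_pow, X_sq, smul_zero]) (by
    have hz : zOf (μ • X k) (μ • Y k + s • X k) = (μ * μ) • Z k := by
      simp [zOf, Z, mul_add, add_mul, X_mul_X, smul_smul]
    have h' : X k * Z k = Z k * X k := by
      simp only [Z, zOf, mul_add, add_mul, mul_assoc, X_mul_X]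
      simp only [← mul_assoc, X_mul_X]
      simp
    have h : Y k * Z k = Z k * Y k + X k * Z k := by
      have := cubic k
      rwa [sub_sub, sub_eq_zero] at this
    rw [hz]
    simp only [add_mul, mul_add, smul_mul_assoc, mul_smul_comm, h, h', smul_add]
    module)

@[simp] theorem sigmaHom_X (s μ : k) : sigmaHom k s μ (X k) = μ • X k := lift_X _ _
@[simp] theorem sigmaHom_Y (s μ : k) : sigmaHom k s μ (Y k) = μ • Y k + s • X k := lift_Y _ _

theorem sigmaHom_comp (s s' μ μ' : k) : (sigmaHom k s μ).comp (sigmaHom k s' μ') =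
    sigmaHom k (μ' * s + μ * s') (μ * μ') := by
  apply hom_ext
  · simp [smul_smul, mul_comm]
  · simp only [AlgHom.comp_apply, sigmaHom_X, sigmaHom_Y, map_add, map_smul]
    module

theorem sigmaHom_id : sigmaHom k 0 1 = AlgHom.id k (Plane k) := by
  apply hom_ext <;> simp

/-- The algebra automorphism `σ_{s,μ}` with `x ↦ μ x` and `y ↦ μ y + s x`, for a scalar `s` and a
nonzero scalar `μ`. -/
def sigma (s : k) (μ : kˣ) : Plane k ≃ₐ[k] Plane k :=
  AlgEquiv.ofAlgHom (sigmaHom k s μ) (sigmaHom k (-((μ⁻¹ : kˣ) * (μ⁻¹ : kˣ) * s)) (μ⁻¹ : kˣ))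
    (by
      rw [sigmaHom_comp, ← sigmaHom_id]
      congr 1
      · linear_combination (-(μ⁻¹ : kˣ) * s : k) * μ.mul_inv
      · simp)
    (by
      rw [sigmaHom_comp, ← sigmaHom_id]
      congr 1
      · linear_combination (-(μ⁻¹ : kˣ) * s : k) * μ.mul_inv
      · simp)

@[simp] theorem sigma_apply (s : k) (μ : kˣ) (a : Plane k) :
    sigma k s μ a = sigmaHom k s μ a := rfl

theorem sigma_mul (s s' : k) (μ μ' : kˣ) :
    sigma k s μ * sigma k s' μ' = sigma k (μ' * s + μ * s') (μ * μ') := by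
  ext a
  simpa using AlgHom.congr_fun (sigmaHom_comp k s s' μ μ') a

theorem sigma_one : sigma k 0 1 = 1 := by
  ext a
  simpa using AlgHom.congr_fun (sigmaHom_id k) a

/-- The group `G` of all `σ_{s,μ}` with `s` a scalar and `μ` a nonzero scalar. -/
def G : Subgroup (Plane k ≃ₐ[k] Plane k) where
  carrier := {σ | ∃ (s : k) (μ : kˣ), σ = sigma k s μ}
  one_mem' := ⟨0, 1, (sigma_one k).symm⟩
  mul_mem' := by
    rintro _ _ ⟨s, μ, rfl⟩ ⟨s', μ', rfl⟩
    exact ⟨_, _, sigma_mul k s s' μ μ'⟩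
  inv_mem' := by
    rintro _ ⟨s, μ, rfl⟩
    refine ⟨-((μ⁻¹ : kˣ) * (μ⁻¹ : kˣ) * s), μ⁻¹, ?_⟩
    rw [inv_eq_iff_mul_eq_one, sigma_mul, ← sigma_one]
    congr 1
    · linear_combination (-(μ⁻¹ : kˣ) * s : k) * μ.mul_inv
    · simp

end Plane

end SuperJordan

end

/-!
# Automorphisms of the super Jordan plane

That the maps in `G` are automorphisms of the braided Hopf algebra and of the superalgebra is a
check on generators: they preserve degrees and commute with `g`, so `σ ⊗ σ` is an algebra map of
the braided tensor square.

Conversely, it suffices that an automorphism `σ` maps the span `V` of `x` and `y` to itself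
(`mem_G_of_mem_V`): then `x ^ 2 = 0` forces `σ x = μ x`, and the cubic relation forces
`σ y = μ y + s x`.

If `σ` is compatible with both structures, then `σ x` and `σ y` are odd and primitive, and odd
primitive elements lie in `V` (`mem_V_of_primitive`). To see this, contract the second factor of
the comultiplication with the functionals dual to `x` and `y`. This gives skew derivations, with
`∂ (a b) = a ∂ b + ∂ a (g b)`, whose values on a primitive element are scalars, so that, after
an element of `V` is subtracted, an odd primitive element is killed by both of them. Now the
monomials `x ^ a z ^ b y ^ c` are a basis, and an odd element is `r y + x s` with `r` and `s` in
the span of the `z ^ b y ^ (2 m)`. Modulo the right ideal generated by `x`, the skew derivation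
for `y` gives `r`, and the one for `x` gives `g s` if `r = 0`; hence `r = s = 0`
(`eq_zero_of_skewDerivation_eq_zero`). Membership in the right ideal is tested by left
multiplication by `x`, which annihilates that ideal.

In characteristic zero the parity assumption is not needed, because `σ` commutes with the braiding.
If `σ a` with `a` in `V` has a nonzero component of degree `n`, then `g ^ n = σ g σ⁻¹`
(`action_pow_apply_of_component_ne_zero`). As `g` has infinite order and the same applies to `σ⁻¹`,
only `n = 1` occurs, and `σ` maps `V` to itself (`mem_V_of_mem_autHopf`).
-/

noncomputable section

namespace SuperJordan

/-! ### Normal forms -/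

section NormalForms

variable (k : Type*) [Field k]

theorem X_mul_Z : X k * Z k = Z k * X k := by
  simp only [Z, zOf, mul_add, add_mul, mul_assoc, X_mul_X]
  simp only [← mul_assoc, X_mul_X]
  simp

theorem Y_mul_Z : Y k * Z k = Z k * Y k + X k * Z k := by
  have := cubic k
  rwa [sub_sub, sub_eq_zero] at this

theorem Y_mul_X : Y k * X k = Z k - X k * Y k := by rw [Z, zOf]; abel

theorem X_mul_Z_pow (b : ℕ) : X k * Z k ^ b = Z k ^ b * X k :=
  (Commute.pow_right (X_mul_Z k) b : Commute _ _)

theorem Y_mul_Z_pow (b : ℕ) :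
    Y k * Z k ^ b = Z k ^ b * Y k + (b : k) • (X k * Z k ^ b) := by
  induction b with
  | zero => simp
  | succ b ih =>
    have h : Z k ^ b * (Y k * Z k) = Z k ^ (b + 1) * Y k + X k * Z k ^ (b + 1) := by
      rw [Y_mul_Z, mul_add, ← mul_assoc, ← mul_assoc, ← X_mul_Z_pow, mul_assoc (X k), pow_succ]
    rw [pow_succ, ← mul_assoc, ih, add_mul, mul_assoc, h, smul_mul_assoc, mul_assoc (X k),
      ← pow_succ]
    push_cast
    module

/-- The monomial `x ^ a * z ^ b * y ^ c` with exponents `(a, b, c)`, where `a ≤ 1` is encoded as a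
Boolean. -/
def monomial : Bool × ℕ × ℕ → Plane k
  | (false, b, c) => Z k ^ b * Y k ^ c
  | (true, b, c) => X k * (Z k ^ b * Y k ^ c)

/-- Left multiplication by `x` in terms of normal forms. -/
def leftX : Module.End k (Bool × ℕ × ℕ →₀ k) :=
  Finsupp.linearCombination k fun t => match t with
    | (false, b, c) => Finsupp.single (true, b, c) 1
    | (true, _, _) => 0

/-- Left multiplication by `y` in terms of normal forms, read off from
`y * z ^ b = z ^ b * y + b * x * z ^ b` and `y * x = z - x * y`. -/
def leftY : Module.End k (Bool × ℕ × ℕ →₀ k) :=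
  Finsupp.linearCombination k fun t => match t with
    | (false, b, c) => Finsupp.single (false, b, c + 1) 1 + Finsupp.single (true, b, c) (b : k)
    | (true, b, c) => Finsupp.single (false, b + 1, c) 1 - Finsupp.single (true, b, c + 1) 1

@[simp] theorem leftX_false (b c : ℕ) (r : k) :
    leftX k (Finsupp.single (false, b, c) r) = Finsupp.single (true, b, c) r := by
  simp [leftX]

@[simp] theorem leftX_true (b c : ℕ) (r : k) :
    leftX k (Finsupp.single (true, b, c) r) = 0 := by
  simp [leftX]

@[simp] theorem leftY_false (b c : ℕ) (r : k) :
    leftY k (Finsupp.single (false, b, c) r) =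
      Finsupp.single (false, b, c + 1) r + Finsupp.single (true, b, c) (r * b) := by
  simp [leftY]

@[simp] theorem leftY_true (b c : ℕ) (r : k) :
    leftY k (Finsupp.single (true, b, c) r) =
      Finsupp.single (false, b + 1, c) r - Finsupp.single (true, b, c + 1) r := by
  simp [leftY, smul_sub]

theorem zOf_left (a : Bool) (b c : ℕ) (r : k) :
    zOf (leftX k) (leftY k) (Finsupp.single (a, b, c) r) = Finsupp.single (a, b + 1, c) r := by
  cases a <;> simp [zOf, -Finsupp.single_mul]

/-- The left regular representation in terms of normal forms. -/
def regularRep : Plane k →ₐ[k] Module.End k (Bool × ℕ × ℕ →₀ k) :=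
  lift (leftX k) (leftY k)
    (by
      refine Finsupp.lhom_ext ?_
      rintro ⟨_ | _, b, c⟩ r <;> simp [sq])
    (by
      refine Finsupp.lhom_ext ?_
      rintro ⟨_ | _, b, c⟩ r
      · simp [zOf_left, mul_add, -Finsupp.single_mul]
      · simp [zOf_left])

/-- The coordinates of an element with respect to the monomials `x ^ a * z ^ b * y ^ c`. -/
def coords : Plane k →ₗ[k] (Bool × ℕ × ℕ →₀ k) :=
  (LinearMap.applyₗ (Finsupp.single (false, 0, 0) 1)).comp (regularRep k).toLinearMap

theorem coords_apply (a : Plane k) :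
    coords k a = regularRep k a (Finsupp.single (false, 0, 0) 1) := rfl

@[simp] theorem regularRep_X : regularRep k (X k) = leftX k := lift_X _ _

@[simp] theorem regularRep_Y : regularRep k (Y k) = leftY k := lift_Y _ _

@[simp] theorem regularRep_Z : regularRep k (Z k) = zOf (leftX k) (leftY k) := by
  simp [Z, zOf]

theorem coords_mul (a b : Plane k) : coords k (a * b) = regularRep k a (coords k b) := by
  simp [coords_apply]

theorem coords_monomial (t : Bool × ℕ × ℕ) : coords k (monomial k t) = Finsupp.single t 1 := by
  have hY (c : ℕ) : coords k (Y k ^ c) = Finsupp.single (false, 0, c) 1 := by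
    induction c with
    | zero => simp [coords_apply]
    | succ c ih => rw [pow_succ', coords_mul, ih]; simp
  have hZ (b c : ℕ) : coords k (Z k ^ b * Y k ^ c) = Finsupp.single (false, b, c) 1 := by
    induction b with
    | zero => simp [hY]
    | succ b ih => rw [pow_succ', mul_assoc, coords_mul, ih, regularRep_Z, zOf_left]
  obtain ⟨_ | _, b, c⟩ := t
  · exact hZ b c
  · rw [monomial, coords_mul, hZ]; simp

@[simp] theorem coords_X : coords k (X k) = Finsupp.single (true, 0, 0) 1 := by
  simpa [monomial] using coords_monomial k (true, 0, 0)

@[simp] theorem coords_Y : coords k (Y k) = Finsupp.single (false, 0, 1) 1 := by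
  simpa [monomial] using coords_monomial k (false, 0, 1)

theorem X_ne_zero : X k ≠ 0 := by
  intro h
  have hX := coords_X k
  rw [h, map_zero] at hX
  simpa using DFunLike.congr_fun hX (true, 0, 0)

/-- The span of the even monomials `z ^ b * y ^ (2 * m)` that do not involve `x`. -/
def evenFree : Submodule k (Plane k) :=
  Submodule.span k (Set.range fun t : ℕ × ℕ => Z k ^ t.1 * (Y k ^ 2) ^ t.2)

/-- Left multiplication by `x` is injective on `evenFree`: a left inverse sends
`x * z ^ b * y ^ c` to `z ^ b * y ^ c`. -/
theorem eq_zero_of_X_mul_eq_zero {r : Plane k} (hr : r ∈ evenFree k) (h : X k * r = 0) :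
    r = 0 := by
  let ρ : Plane k →ₗ[k] Plane k :=
    (Finsupp.linearCombination k fun t : Bool × ℕ × ℕ => Z k ^ t.2.1 * Y k ^ t.2.2) ∘ₗ coords k
  have key : ρ (X k * r) = r := by
    clear h
    induction hr using Submodule.span_induction with
    | mem u hu =>
      obtain ⟨⟨b, m⟩, rfl⟩ := hu
      have := coords_monomial k (true, b, 2 * m)
      rw [monomial] at this
      simp only [ρ, LinearMap.comp_apply, ← pow_mul, this]
      simp
    | zero => simp
    | add u v _ _ hu hv => rw [mul_add, map_add, hu, hv]
    | smul r u _ hu => rw [mul_smul_comm, map_smul, hu]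
  rw [← key, h, map_zero]

/-- The span of the monomials `x ^ a * z ^ b * y ^ c` with `a + c` of parity `i`. -/
def paritySpan (i : ZMod 2) : Submodule k (Plane k) :=
  Submodule.span k (monomial k '' {t | ((t.1.toNat + t.2.2 : ℕ) : ZMod 2) = i})

theorem monomial_mem_paritySpan {i : ZMod 2} (t : Bool × ℕ × ℕ)
    (h : ((t.1.toNat + t.2.2 : ℕ) : ZMod 2) = i) : monomial k t ∈ paritySpan k i :=
  Submodule.subset_span ⟨t, h, rfl⟩

theorem mul_mem_paritySpan {i : ZMod 2} {v a : Plane k} (hv : v ∈ V k)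
    (ha : a ∈ paritySpan k i) : v * a ∈ paritySpan k (i + 1) := by
  have hX : X k * a ∈ paritySpan k (i + 1) := by
    induction ha using Submodule.span_induction with
    | mem u hu =>
      obtain ⟨⟨_ | _, b, c⟩, h, rfl⟩ := hu
      · refine monomial_mem_paritySpan k (true, b, c) ?_
        rw [← (show _ = i from h)]; simp [add_comm]
      · rw [monomial, ← mul_assoc, X_mul_X, zero_mul]; exact zero_mem _
    | zero => simp
    | add u v _ _ hu hv => rw [mul_add]; exact add_mem hu hv
    | smul r u _ hu => rw [mul_smul_comm]; exact Submodule.smul_mem _ _ hu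
  have hY : Y k * a ∈ paritySpan k (i + 1) := by
    clear hX
    induction ha using Submodule.span_induction with
    | mem u hu =>
      obtain ⟨⟨_ | _, b, c⟩, h, rfl⟩ := hu
      · have e : Y k * monomial k (false, b, c) =
            monomial k (false, b, c + 1) + (b : k) • monomial k (true, b, c) := by
          simp only [monomial]
          rw [← mul_assoc, Y_mul_Z_pow, add_mul, mul_assoc, ← pow_succ', smul_mul_assoc, mul_assoc]
        rw [e, ← (show _ = i from h)]
        refine add_mem (monomial_mem_paritySpan k _ ?_)
          (Submodule.smul_mem _ _ (monomial_mem_paritySpan k _ ?_)) <;> simp [add_comm]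
      · have e : Y k * monomial k (true, b, c) = monomial k (false, b + 1, c)
            - monomial k (true, b, c + 1) := by
          have h0 : X k * X k * Z k ^ b = 0 := by rw [X_mul_X, zero_mul]
          have h1 : X k * (Y k * Z k ^ b) = X k * Z k ^ b * Y k := by
            rw [Y_mul_Z_pow, mul_add, mul_smul_comm, ← mul_assoc, ← mul_assoc, h0, smul_zero,
              add_zero]
          simp only [monomial]
          rw [← mul_assoc, Y_mul_X, sub_mul, pow_succ' (Z k), mul_assoc (Z k)]
          congr 1
          rw [← mul_assoc, mul_assoc (X k), h1, pow_succ']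
          simp only [mul_assoc]
        rw [e, ← (show _ = i from h)]
        have h2 : (1 : ZMod 2) + 1 = 0 := rfl
        refine sub_mem (monomial_mem_paritySpan k _ ?_) (monomial_mem_paritySpan k _ ?_)
        · simp only [Bool.toNat_true, Bool.toNat_false]
          push_cast
          linear_combination -h2
        · simp only [Bool.toNat_true]
          push_cast
          ring
    | zero => simp
    | add u v _ _ hu hv => rw [mul_add]; exact add_mem hu hv
    | smul r u _ hu => rw [mul_smul_comm]; exact Submodule.smul_mem _ _ hu
  obtain ⟨α, β, rfl⟩ := Submodule.mem_span_pair.mp hv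
  rw [add_mul, smul_mul_assoc, smul_mul_assoc]
  exact add_mem (Submodule.smul_mem _ _ hX) (Submodule.smul_mem _ _ hY)

theorem homog_le_paritySpan (n : ℕ) : homog k n ≤ paritySpan k n := by
  intro a ha
  rw [homog] at ha
  induction ha using Submodule.pow_induction_on_left' with
  | algebraMap r =>
    rw [Algebra.algebraMap_eq_smul_one]
    refine Submodule.smul_mem _ _ ?_
    simpa [monomial] using monomial_mem_paritySpan k (i := 0) (false, 0, 0) (by simp)
  | add a b n _ _ iha ihb => exact add_mem iha ihb
  | mem_mul m hm n a _ ih =>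
    rw [Nat.cast_succ]
    exact mul_mem_paritySpan k hm ih

/-- An odd element has the form `r * y + x * s` with `r` and `s` even and free of `x`. -/
theorem exists_of_mem_superPart_one {a : Plane k} (ha : a ∈ superPart k 1) :
    ∃ r ∈ evenFree k, ∃ s ∈ evenFree k, a = r * Y k + X k * s := by
  have h : superPart k 1 ≤ paritySpan k 1 :=
    iSup₂_le fun n hn => hn ▸ homog_le_paritySpan k n
  replace ha := h ha
  clear h
  induction ha using Submodule.span_induction with
  | mem u hu =>
    obtain ⟨⟨_ | _, b, c⟩, h, rfl⟩ := hu
    · have hc : (c : ZMod 2) = 1 := by simpa using h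
      obtain ⟨m, rfl⟩ := (ZMod.natCast_eq_one_iff_odd).mp hc
      refine ⟨_, Submodule.subset_span ⟨(b, m), rfl⟩, 0, zero_mem _, ?_⟩
      simp [monomial, pow_succ _ (2 * m), pow_mul, mul_assoc]
    · have hc : (c : ZMod 2) = 0 := by simpa using h
      obtain ⟨m, rfl⟩ := (ZMod.natCast_eq_zero_iff_even).mp hc
      refine ⟨0, zero_mem _, _, Submodule.subset_span ⟨(b, m), rfl⟩, ?_⟩
      simp [monomial, ← two_mul, pow_mul]
  | zero => exact ⟨0, zero_mem _, 0, zero_mem _, by simp⟩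
  | add u v _ _ hu hv =>
    obtain ⟨r, hr, s, hs, rfl⟩ := hu
    obtain ⟨r', hr', s', hs', rfl⟩ := hv
    exact ⟨r + r', add_mem hr hr', s + s', add_mem hs hs', by noncomm_ring⟩
  | smul t u _ hu =>
    obtain ⟨r, hr, s, hs, rfl⟩ := hu
    exact ⟨t • r, Submodule.smul_mem _ _ hr, t • s, Submodule.smul_mem _ _ hs, by simp⟩

end NormalForms

/-! ### Skew derivations and odd primitive elements -/

section SkewDerivations

variable (k : Type*) [Field k]

section

variable {k}

/-- The algebra map to the dual numbers with `x ↦ α ε` and `y ↦ β ε`. -/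
def tangent (α β : k) : Plane k →ₐ[k] DualNumber k :=
  lift (α • DualNumber.eps) (β • DualNumber.eps)
    (by simp [sq])
    (by simp [zOf])

/-- The linear functional that takes `x` to `α` and `y` to `β` and vanishes in all other degrees. -/
def tangentFunctional (α β : k) : Plane k →ₗ[k] k :=
  (TrivSqZeroExt.sndHom k k).comp (tangent α β).toLinearMap

@[simp] theorem tangentFunctional_X (α β : k) : tangentFunctional α β (X k) = α := by
  simp [tangentFunctional, tangent]

@[simp] theorem tangentFunctional_Y (α β : k) : tangentFunctional α β (Y k) = β := by
  simp [tangentFunctional, tangent]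

@[simp] theorem tangentFunctional_one (α β : k) : tangentFunctional α β 1 = 0 := by
  simp [tangentFunctional]

@[simp] theorem counit_X : counit k (X k) = 0 := lift_X _ _

@[simp] theorem counit_Y : counit k (Y k) = 0 := lift_Y _ _

theorem fst_tangent (α β : k) (a : Plane k) : (tangent α β a).fst = counit k a := by
  have : (TrivSqZeroExt.fstHom k k k).comp (tangent α β) = counit k := by
    apply hom_ext <;> simp [tangent]
  exact AlgHom.congr_fun this a

theorem tangentFunctional_mul (α β : k) (a b : Plane k) :
    tangentFunctional α β (a * b) =
      counit k a * tangentFunctional α β b + tangentFunctional α β a * counit k b := by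
  simp [tangentFunctional, fst_tangent, mul_comm]

theorem counit_of_mem_V {a : Plane k} (ha : a ∈ V k) : counit k a = 0 := by
  obtain ⟨s, t, rfl⟩ := Submodule.mem_span_pair.mp ha
  simp

theorem counit_of_mem_homog {n : ℕ} {a : Plane k} (ha : a ∈ homog k n) (hn : n ≠ 0) :
    counit k a = 0 := by
  rw [homog] at ha
  induction ha using Submodule.pow_induction_on_left' with
  | algebraMap r => exact absurd rfl hn
  | add a b n _ _ iha ihb => rw [map_add, iha hn, ihb hn, add_zero]
  | mem_mul m hm n a _ ih => rw [map_mul, counit_of_mem_V hm, zero_mul]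

theorem tangentFunctional_of_mem_homog (α β : k) {n : ℕ} {a : Plane k} (ha : a ∈ homog k n)
    (hn : n ≠ 1) : tangentFunctional α β a = 0 := by
  rw [homog] at ha
  induction ha using Submodule.pow_induction_on_left' with
  | algebraMap r => simp [Algebra.algebraMap_eq_smul_one]
  | add a b n _ _ iha ihb => rw [map_add, iha hn, ihb hn, add_zero]
  | mem_mul m hm n a ha ih =>
    rw [tangentFunctional_mul, counit_of_mem_V hm, counit_of_mem_homog ha (by omega)]
    simp

end

/-- The map `id ⊗ f` from the braided tensor square to the algebra, for a linear functional `f`. -/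
def contractRight (f : Plane k →ₗ[k] k) : Square k →ₗ[k] Plane k :=
  (TensorProduct.rid k (Plane k)).toLinearMap ∘ₗ LinearMap.lTensor (Plane k) f ∘ₗ
    (toBraided (homog k) (action k)).symm.toLinearMap

@[simp] theorem contractRight_pureTensor (f : Plane k →ₗ[k] k) (a b : Plane k) :
    contractRight k f (pureTensor k a b) = f b • a := by
  simp [contractRight, pureTensor]

/-- Induction on two elements of the braided tensor square; the second factor of the first pure
tensor may be taken homogeneous, so that `pureTensor_mul` applies. -/
theorem square_induction₂ {P : Square k → Square k → Prop}
    (zero_left : ∀ v, P 0 v) (zero_right : ∀ u, P u 0)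
    (add_left : ∀ u u' v, P u v → P u' v → P (u + u') v)
    (add_right : ∀ u v v', P u v → P u v' → P u (v + v'))
    (tmul : ∀ (a b a' b' : Plane k) (n : ℕ), b ∈ homog k n →
      P (pureTensor k a b) (pureTensor k a' b')) (u v : Square k) : P u v := by
  induction u using BraidedTensor.induction with
  | h0 => exact zero_left v
  | hadd u u' hu hu' => exact add_left _ _ _ hu hu'
  | ht a b n hb =>
    induction v using BraidedTensor.induction with
    | h0 => exact zero_right _
    | hadd v v' hv hv' => exact add_right _ _ _ hv hv'
    | ht a' b' n' _ => exact tmul a b a' b' n hb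

/-- The map `id ⊗ ε`, which is multiplicative because `g ^ 0 = id`. -/
def contractCounit : Square k →ₐ[k] Plane k :=
  AlgHom.ofLinearMap (contractRight k (counit k).toLinearMap)
    ((contractRight_pureTensor k _ 1 1).trans (by simp))
    (by
      refine square_induction₂ k (by simp) (by simp) ?_ ?_ ?_
      · intro u u' v hu hu'; rw [add_mul, map_add, hu, hu', map_add, add_mul]
      · intro u v v' hv hv'; rw [mul_add, map_add, hv, hv', map_add, mul_add]
      · intro a b a' b' n hb
        rw [pureTensor_mul k a a' b' hb]
        simp only [contractRight_pureTensor, AlgHom.toLinearMap_apply, map_mul]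
        rcases eq_or_ne n 0 with rfl | hn
        · simp [smul_smul, mul_comm]
        · simp [counit_of_mem_homog hb hn])

@[simp] theorem contractCounit_pureTensor (a b : Plane k) :
    contractCounit k (pureTensor k a b) = counit k b • a := contractRight_pureTensor k _ a b

theorem contractCounit_comulHom (a : Plane k) : contractCounit k (comulHom k a) = a := by
  have : (contractCounit k).comp (comulHom k) = AlgHom.id k (Plane k) := by
    apply hom_ext <;> simp [comulHom, prim]
  exact AlgHom.congr_fun this a

variable {k} in
theorem contractRight_tangentFunctional_mul (α β : k) (u v : Square k) :
    contractRight k (tangentFunctional α β) (u * v) =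
      contractCounit k u * contractRight k (tangentFunctional α β) v +
        contractRight k (tangentFunctional α β) u * action k (contractCounit k v) := by
  revert u v
  refine square_induction₂ k (by simp) (by simp) ?_ ?_ ?_
  · intro u u' v hu hu'; simp only [add_mul, map_add, hu, hu']; abel
  · intro u v v' hv hv'; simp only [mul_add, map_add, hv, hv']; abel
  · intro a b a' b' n hb
    rw [pureTensor_mul k a a' b' hb]
    simp only [contractRight_pureTensor, contractCounit_pureTensor, tangentFunctional_mul, map_smul]
    rcases eq_or_ne n 0 with rfl | h0
    · simp [tangentFunctional_of_mem_homog α β hb, smul_smul, mul_comm]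
    · rw [counit_of_mem_homog hb h0]
      rcases eq_or_ne n 1 with rfl | h1
      · simp [smul_smul, mul_comm]
      · simp [tangentFunctional_of_mem_homog α β hb h1]

variable {k}

/-- The skew derivation of the super Jordan plane that takes `x` to `α` and `y` to `β`, obtained
by contracting the second factor of the comultiplication with `tangentFunctional α β`. -/
def skewDerivation (α β : k) : Plane k →ₗ[k] Plane k :=
  contractRight k (tangentFunctional α β) ∘ₗ (comulHom k).toLinearMap

theorem skewDerivation_mul (α β : k) (a b : Plane k) : skewDerivation α β (a * b) =
    a * skewDerivation α β b + skewDerivation α β a * action k b := by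
  simp [skewDerivation, contractRight_tangentFunctional_mul, contractCounit_comulHom]

theorem skewDerivation_of_primitive (α β : k) {a : Plane k} (ha : comulHom k a = prim k a) :
    skewDerivation α β a = tangentFunctional α β a • 1 := by
  simp [skewDerivation, ha, prim]

theorem comulHom_X : comulHom k (X k) = prim k (X k) := lift_X _ _

theorem comulHom_Y : comulHom k (Y k) = prim k (Y k) := lift_Y _ _

@[simp] theorem skewDerivation_X (α β : k) : skewDerivation α β (X k) = α • 1 := by
  rw [skewDerivation_of_primitive α β comulHom_X, tangentFunctional_X]

@[simp] theorem skewDerivation_Y (α β : k) : skewDerivation α β (Y k) = β • 1 := by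
  rw [skewDerivation_of_primitive α β comulHom_Y, tangentFunctional_Y]

@[simp] theorem skewDerivation_one (α β : k) : skewDerivation α β (1 : Plane k) = 0 := by
  rw [skewDerivation, LinearMap.comp_apply, AlgHom.toLinearMap_apply, map_one]
  exact (contractRight_pureTensor k _ 1 1).trans (by simp)

theorem skewDerivation_Z_pow (b : ℕ) : skewDerivation (0 : k) 1 (Z k ^ b) = 0 := by
  have hZ : skewDerivation (0 : k) 1 (Z k) = 0 := by
    simp [Z, zOf, skewDerivation_mul]
  induction b with
  | zero => simp
  | succ b ih => rw [pow_succ, skewDerivation_mul, hZ, ih]; simp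

theorem X_mul_Y_sq (a : Plane k) :
    X k * (Y k ^ 2 * a) = Y k ^ 2 * (X k * a) - Z k * (X k * a) := by
  have h₁ : X k * Y k = Z k - Y k * X k := by rw [Z, zOf]; abel
  have h : X k * Y k ^ 2 = Y k ^ 2 * X k - Z k * X k := by
    rw [sq, ← mul_assoc, h₁, sub_mul, mul_assoc, h₁, mul_sub, Y_mul_Z, X_mul_Z]
    noncomm_ring
  rw [← mul_assoc, h]
  noncomm_ring

/-- The skew derivation `∂ / ∂y` maps `evenFree` to the right annihilator of `x`, that is, to the
right ideal generated by `x`; on powers of `y ^ 2` this rests on `∂ (y ^ 2) = x`. -/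
theorem X_mul_skewDerivation {r : Plane k} (hr : r ∈ evenFree k) :
    X k * skewDerivation (0 : k) 1 r = 0 := by
  have hY : skewDerivation (0 : k) 1 (Y k ^ 2) = X k := by
    simp [sq, skewDerivation_mul]
  have hpow (m : ℕ) : X k * skewDerivation (0 : k) 1 ((Y k ^ 2) ^ m) = 0 := by
    induction m with
    | zero => simp
    | succ m ih =>
      rw [pow_succ', skewDerivation_mul, mul_add, X_mul_Y_sq, ih, hY, ← mul_assoc, X_mul_X]
      simp
  induction hr using Submodule.span_induction with
  | mem u hu =>
    obtain ⟨⟨b, m⟩, rfl⟩ := hu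
    dsimp only
    rw [skewDerivation_mul, skewDerivation_Z_pow, zero_mul, add_zero, ← mul_assoc, X_mul_Z_pow,
      mul_assoc, hpow, mul_zero]
  | zero => simp
  | add u v _ _ hu hv => rw [map_add, mul_add, hu, hv, add_zero]
  | smul t u _ hu => rw [map_smul, mul_smul_comm, hu, smul_zero]

theorem action_eq : action k = sigmaHom k 1 (-1) := by
  apply hom_ext <;> simp

/-- The right annihilator of `x` is stable under the inverse of `g`. -/
theorem X_mul_eq_zero_of_X_mul_action {a : Plane k} (h : X k * action k a = 0) : X k * a = 0 := by
  have hinv : (sigmaHom k (-1) (-1)).comp (action k) = AlgHom.id k (Plane k) := by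
    rw [action_eq, sigmaHom_comp, ← sigmaHom_id]
    congr 1 <;> ring
  have := congrArg (sigmaHom k (-1) (-1)) h
  rw [map_mul, ← AlgHom.comp_apply, hinv] at this
  simpa using this

/-- The common kernel of the skew derivations contains no nonzero odd element. -/
theorem eq_zero_of_skewDerivation_eq_zero {a : Plane k} (ha : a ∈ superPart k 1)
    (hx : skewDerivation (1 : k) 0 a = 0) (hy : skewDerivation (0 : k) 1 a = 0) : a = 0 := by
  obtain ⟨r, hr, s, hs, rfl⟩ := exists_of_mem_superPart_one k ha
  have hr0 : r = 0 := by
    refine eq_zero_of_X_mul_eq_zero k hr ?_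
    have := congrArg (X k * ·) hy
    simpa [skewDerivation_mul, mul_add, ← mul_assoc, X_mul_skewDerivation hr, X_mul_X] using this
  subst hr0
  have hs0 : s = 0 := by
    refine eq_zero_of_X_mul_eq_zero k hs (X_mul_eq_zero_of_X_mul_action ?_)
    have := congrArg (X k * ·) hx
    simpa [skewDerivation_mul, mul_add, ← mul_assoc, X_mul_X] using this
  simp [hs0]

theorem homog_le_superPart (n : ℕ) : homog k n ≤ superPart k n :=
  le_iSup₂_of_le n rfl le_rfl

theorem V_eq_homog_one : V k = homog k 1 := (pow_one _).symm

theorem V_le_superPart_one : V k ≤ superPart k 1 := by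
  rw [V_eq_homog_one]
  simpa using homog_le_superPart (k := k) 1

/-- Odd primitive elements have degree one. -/
theorem mem_V_of_primitive {a : Plane k} (ha : comulHom k a = prim k a)
    (hodd : a ∈ superPart k 1) : a ∈ V k := by
  set v := tangentFunctional 1 0 a • X k + tangentFunctional 0 1 a • Y k with hv
  have hvV : v ∈ V k :=
    add_mem (Submodule.smul_mem _ _ (X_mem_V k)) (Submodule.smul_mem _ _ (Y_mem_V k))
  have : a - v = 0 := by
    refine eq_zero_of_skewDerivation_eq_zero (sub_mem hodd (V_le_superPart_one hvV)) ?_ ?_ <;>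
      simp [hv, skewDerivation_of_primitive _ _ ha]
  rwa [sub_eq_zero.mp this]

end SkewDerivations

/-! ### Algebra automorphisms that preserve the generating space -/

section Automorphisms

variable {k : Type*} [Field k]

/-- An algebra automorphism that is linear on generators belongs to `G`: the relation `x ^ 2 = 0`
makes `x` an eigenvector, and the cubic relation makes the two eigenvalues equal. -/
theorem mem_G_of_mem_V {σ : Plane k ≃ₐ[k] Plane k} (hX : σ (X k) ∈ V k) (hY : σ (Y k) ∈ V k) :
    σ ∈ G k := by
  obtain ⟨a, b, hab⟩ := Submodule.mem_span_pair.mp hX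
  obtain ⟨s, ν, hsν⟩ := Submodule.mem_span_pair.mp hY
  have cZ : coords k (Z k) = Finsupp.single (false, 1, 0) 1 := by
    simpa [monomial] using coords_monomial k (false, 1, 0)
  have cXZ : coords k (X k * Z k) = Finsupp.single (true, 1, 0) 1 := by
    simpa [monomial] using coords_monomial k (true, 1, 0)
  have cYY : coords k (Y k * Y k) = Finsupp.single (false, 0, 2) 1 := by
    simpa [monomial, sq] using coords_monomial k (false, 0, 2)
  have hb : b = 0 := by
    have h : (a * b) • Z k + (b * b) • (Y k * Y k) = 0 := by
      have h₀ : σ (X k) * σ (X k) = 0 := by rw [← map_mul, X_mul_X, map_zero]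
      rw [← h₀, ← hab, Z, zOf]
      simp only [mul_add, add_mul, smul_mul_smul_comm, X_mul_X, smul_add, smul_zero, mul_comm b a]
      abel
    have := DFunLike.congr_fun (congrArg (coords k) h) (false, 0, 2)
    simpa [cZ, cYY] using this
  subst hb
  rw [zero_smul, add_zero] at hab
  have ha : a ≠ 0 := by
    rintro rfl
    exact X_ne_zero k (σ.injective (by rw [← hab, zero_smul, map_zero]))
  have hν : ν ≠ 0 := by
    rintro rfl
    have h : a • Y k - s • X k = 0 := σ.injective (by
      rw [map_sub, map_smul, map_smul, ← hab, ← hsν, map_zero]; module)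
    have := DFunLike.congr_fun (congrArg (coords k) h) (false, 0, 1)
    exact ha (by simpa [coords_X, coords_Y] using this)
  have hZ : σ (Z k) = (a * ν) • Z k := by
    rw [Z, zOf, map_add, map_mul, map_mul, ← hab, ← hsν]
    simp only [mul_add, add_mul, smul_mul_smul_comm, X_mul_X, smul_add, smul_zero, mul_comm ν a,
      zero_add]
  have hνa : ν = a := by
    have h : (a * ν * (ν - a)) • (X k * Z k) = 0 := by
      have h₀ := congrArg σ (cubic k)
      rw [map_sub, map_sub, map_mul, map_mul, map_mul, map_zero, hZ, ← hab, ← hsν] at h₀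
      rw [← h₀]
      simp only [mul_add, add_mul, smul_mul_smul_comm, Y_mul_Z, ← X_mul_Z, smul_add]
      module
    have := DFunLike.congr_fun (congrArg (coords k) h) (true, 1, 0)
    have : (a = 0 ∨ ν = 0) ∨ ν - a = 0 := by simpa [cXZ] using this
    exact sub_eq_zero.mp (by tauto)
  subst hνa
  refine ⟨s, Units.mk0 ν ha, AlgEquiv.ext fun u => ?_⟩
  have : (σ : Plane k →ₐ[k] Plane k) = sigmaHom k s ν := by
    apply hom_ext
    · simp [hab]
    · simp [← hsν, add_comm]
  exact AlgHom.congr_fun this u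

/-! ### Braided Hopf algebra automorphisms -/

theorem comulHom_eq_prim_of_mem_V {a : Plane k} (ha : a ∈ V k) : comulHom k a = prim k a := by
  obtain ⟨s, t, rfl⟩ := Submodule.mem_span_pair.mp ha
  simp [comulHom_X, comulHom_Y, prim, pureTensor, TensorProduct.add_tmul, TensorProduct.tmul_add,
    ← TensorProduct.smul_tmul', TensorProduct.tmul_smul]
  abel

theorem comulHom_apply_of_mem_autHopf {σ : Plane k ≃ₐ[k] Plane k} (hσ : σ ∈ autHopf k)
    {a : Plane k} (ha : a ∈ V k) : comulHom k (σ a) = prim k (σ a) := by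
  have h := congrArg (toBraided (homog k) (action k)) (hσ.1 a)
  have e (a : Plane k) : comul k a = (toBraided (homog k) (action k)).symm (comulHom k a) := rfl
  rw [e, e, LinearEquiv.apply_symm_apply, comulHom_eq_prim_of_mem_V ha] at h
  rw [h]
  simp [prim, pureTensor]

theorem autHopf_inf_autSuper_le : autHopf k ⊓ autSuper k ≤ G k := by
  rintro σ ⟨hH, hS⟩
  have h {a : Plane k} (ha : a ∈ V k) : σ a ∈ V k := by
    refine mem_V_of_primitive (comulHom_apply_of_mem_autHopf hH ha) ?_
    rw [← hS 1]
    exact Submodule.mem_map_of_mem (V_le_superPart_one ha)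
  exact mem_G_of_mem_V (h (X_mem_V k)) (h (Y_mem_V k))

/-! ### Homogeneity in characteristic zero -/

/-- Compatibility with the braiding forces `g ^ n σ = σ g` as soon as the image of a generator has
a nonzero component of degree `n`. -/
theorem action_pow_apply_of_component_ne_zero {σ : Plane k ≃ₐ[k] Plane k} (hσ : σ ∈ autHopf k)
    {a : Plane k} (ha : a ∈ V k) {n : ℕ}
    (hn : GradedRing.proj (homog k) n (σ a) ≠ 0) (b : Plane k) :
    (action k ^ n) (σ b) = σ (action k b) := by
  let π : Plane k →ₗ[k] Plane k :=
    (homog k n).subtype ∘ₗ DirectSum.component k ℕ (fun i => homog k i) n ∘ₗ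
      (DirectSum.decomposeLinearEquiv (homog k)).toLinearMap
  have hπ (u : Plane k) : π u = GradedRing.proj (homog k) n u := rfl
  have key (u v : Plane k) :
      LinearMap.lTensor (Plane k) π (c k (u ⊗ₜ v)) = (action k ^ n) v ⊗ₜ π u := by
    induction u using DirectSum.Decomposition.inductionOn (homog k) with
    | zero => simp
    | add u u' hu hu' =>
      rw [TensorProduct.add_tmul, map_add, map_add, hu, hu', map_add, TensorProduct.tmul_add]
    | @homogeneous i m =>
      rw [c, braiding_tmul _ _ m.2, LinearMap.lTensor_tmul]
      rcases eq_or_ne i n with rfl | hi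
      · rfl
      · have : π (m : Plane k) = 0 := by
          rw [hπ, GradedRing.proj_apply]
          exact DirectSum.decompose_of_mem_ne (homog k) m.2 hi
        rw [this, TensorProduct.tmul_zero, TensorProduct.tmul_zero]
  have h := hσ.2.2 (a ⊗ₜ b)
  rw [c, braiding_tmul _ _ (V_eq_homog_one (k := k) ▸ ha), pow_one, TensorProduct.map_tmul,
    TensorProduct.map_tmul] at h
  have h' := congrArg (LinearMap.lTensor (Plane k) π) h
  rw [AlgEquiv.toLinearMap_apply, AlgEquiv.toLinearMap_apply, key, LinearMap.lTensor_tmul] at h'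
  obtain ⟨f, hf⟩ := Module.Projective.exists_dual_eq_one k (show π (σ a) ≠ 0 from hn)
  simpa [hf] using congrArg (TensorProduct.rid k _ ∘ LinearMap.lTensor (Plane k) f) h'

theorem action_pow_Y (n : ℕ) :
    (action k ^ n) (Y k) = (-1 : k) ^ n • (Y k - (n : k) • X k) := by
  induction n with
  | zero => simp
  | succ n ih =>
    rw [pow_succ', AlgHom.mul_apply, ih, map_smul, map_sub, map_smul, action_X, action_Y]
    push_cast
    rw [pow_succ]
    module

/-- In characteristic zero the automorphism `g` has infinite order. -/
theorem eq_one_of_action_pow_eq [CharZero k] {n : ℕ} (h : action k ^ n = action k) : n = 1 := by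
  have h₁ := AlgHom.congr_fun h (Y k)
  rw [action_pow_Y, action_Y] at h₁
  have hy := DFunLike.congr_fun (congrArg (coords k) h₁) (false, 0, 1)
  have hx := DFunLike.congr_fun (congrArg (coords k) h₁) (true, 0, 0)
  have hy' : (-1 : k) ^ n = -1 := by simpa [coords_X, coords_Y] using hy
  have hx' : (n : k) = 1 := by simpa [coords_X, coords_Y, hy'] using hx
  exact_mod_cast hx'

theorem exists_component_ne_zero {a : Plane k} (ha : a ≠ 0) :
    ∃ n, GradedRing.proj (homog k) n a ≠ 0 := by
  by_contra! h
  refine ha ((DirectSum.decompose (homog k)).injective ?_)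
  rw [DirectSum.decompose_zero]
  refine DFinsupp.ext fun n => Subtype.ext ?_
  simpa [GradedRing.proj_apply] using h n

theorem mem_V_of_mem_autHopf [CharZero k] {σ : Plane k ≃ₐ[k] Plane k} (hσ : σ ∈ autHopf k)
    {a : Plane k} (ha : a ∈ V k) : σ a ∈ V k := by
  -- If `σ⁻¹ x` has a component of degree `m` and `σ a` one of degree `n`, then
  -- `g = σ g ^ m σ⁻¹ = (σ g σ⁻¹) ^ m = (g ^ n) ^ m`, so that `n * m = 1`.
  obtain ⟨m, hm⟩ := exists_component_ne_zero (a := σ⁻¹ (X k))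
    fun h => X_ne_zero k ((σ⁻¹).injective (h.trans (map_zero _).symm))
  have hinv := action_pow_apply_of_component_ne_zero (inv_mem hσ) (X_mem_V k) hm
  have hdeg {n : ℕ} (hn : GradedRing.proj (homog k) n (σ a) ≠ 0) : n = 1 := by
    have hcomm := action_pow_apply_of_component_ne_zero hσ ha hn
    have hiter (j : ℕ) (b : Plane k) :
        ((action k ^ n) ^ j) (σ b) = σ ((action k ^ j) b) := by
      induction j generalizing b with
      | zero => simp
      | succ j ih => rw [pow_succ, AlgHom.mul_apply, hcomm, ih, pow_succ]; rfl
    refine Nat.eq_one_of_mul_eq_one_right (m := n) (n := m) (eq_one_of_action_pow_eq (k := k) ?_)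
    refine AlgHom.ext fun b => ?_
    have e : σ (σ⁻¹ b) = b := σ.apply_symm_apply b
    have e' : σ (σ⁻¹ (action k b)) = action k b := σ.apply_symm_apply _
    rw [pow_mul, ← e, hiter, hinv, e, e']
  classical
  rw [V_eq_homog_one, ← DirectSum.sum_support_decompose (homog k) (σ a)]
  refine Submodule.sum_mem _ fun n hn => ?_
  have : n = 1 := hdeg (by simpa [GradedRing.proj_apply] using hn)
  subst this
  exact SetLike.coe_mem _

/-! ### The automorphisms in the group `G` -/

theorem sigma_mem_homog (s : k) (μ : kˣ) {n : ℕ} {a : Plane k} (ha : a ∈ homog k n) :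
    sigma k s μ a ∈ homog k n := by
  have hV : (V k).map (sigmaHom k s μ).toLinearMap ≤ V k := by
    rw [V, Submodule.map_span_le]
    rintro _ (rfl | rfl)
    · rw [AlgHom.toLinearMap_apply, sigmaHom_X]
      exact Submodule.smul_mem _ _ (X_mem_V k)
    · rw [AlgHom.toLinearMap_apply, sigmaHom_Y]
      exact add_mem (Submodule.smul_mem _ _ (Y_mem_V k)) (Submodule.smul_mem _ _ (X_mem_V k))
  have h : (homog k n).map (sigmaHom k s μ).toLinearMap ≤ homog k n := by
    rw [homog, Submodule.map_pow]
    exact pow_le_pow_left' hV n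
  exact h (Submodule.mem_map_of_mem ha)

theorem action_pow_sigma (s : k) (μ : kˣ) (n : ℕ) (b : Plane k) :
    (action k ^ n) (sigma k s μ b) = sigma k s μ ((action k ^ n) b) := by
  have h : (action k) * (sigmaHom k s μ) = (sigmaHom k s μ) * (action k) := by
    change (action k).comp _ = AlgHom.comp _ (action k)
    rw [action_eq, sigmaHom_comp, sigmaHom_comp]
    congr 1 <;> ring
  exact AlgHom.congr_fun (Commute.pow_left (show Commute _ _ from h) n : _ * _ = _ * _) b

/-- The map `σ ⊗ σ` is an endomorphism of the braided tensor square, for `σ` in `G`. -/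
def sigmaSquare (s : k) (μ : kˣ) : Square k →ₐ[k] Square k :=
  AlgHom.ofLinearMap
    ((toBraided (homog k) (action k)).toLinearMap ∘ₗ
      TensorProduct.map (sigma k s μ).toLinearMap (sigma k s μ).toLinearMap ∘ₗ
      (toBraided (homog k) (action k)).symm.toLinearMap)
    (by
      change pureTensor k (sigma k s μ 1) (sigma k s μ 1) = pureTensor k 1 1
      rw [map_one])
    (by
      refine square_induction₂ k (by simp) (by simp) ?_ ?_ ?_
      · intro u u' v hu hu'; rw [add_mul, map_add, hu, hu', map_add, add_mul]
      · intro u v v' hv hv'; rw [mul_add, map_add, hv, hv', map_add, mul_add]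
      · intro a b a' b' n hb
        rw [pureTensor_mul k a a' b' hb]
        change pureTensor k (sigma k s μ _) (sigma k s μ _) =
          pureTensor k (sigma k s μ _) (sigma k s μ _) *
            pureTensor k (sigma k s μ _) (sigma k s μ _)
        rw [pureTensor_mul k _ _ _ (sigma_mem_homog s μ hb), action_pow_sigma, map_mul, map_mul])

theorem sigmaSquare_prim (s : k) (μ : kˣ) (a : Plane k) :
    sigmaSquare s μ (prim k a) = prim k (sigma k s μ a) := by
  have h (a b : Plane k) : sigmaSquare s μ (pureTensor k a b) =
      pureTensor k (sigma k s μ a) (sigma k s μ b) := rfl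
  rw [prim, map_add, h, h, map_one, prim]

theorem sigma_mem_autHopf (s : k) (μ : kˣ) : sigma k s μ ∈ autHopf k := by
  have hV {a : Plane k} (ha : a ∈ V k) : sigma k s μ a ∈ V k := by
    rw [V_eq_homog_one] at ha ⊢
    exact sigma_mem_homog s μ ha
  refine ⟨fun a => ?_, fun a => ?_, fun u => ?_⟩
  · have h : (comulHom k).comp (sigmaHom k s μ) = (sigmaSquare s μ).comp (comulHom k) := by
      apply hom_ext
      · rw [AlgHom.comp_apply, AlgHom.comp_apply, comulHom_X, sigmaSquare_prim]
        exact comulHom_eq_prim_of_mem_V (hV (X_mem_V k))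
      · rw [AlgHom.comp_apply, AlgHom.comp_apply, comulHom_Y, sigmaSquare_prim]
        exact comulHom_eq_prim_of_mem_V (hV (Y_mem_V k))
    exact congrArg (toBraided (homog k) (action k)).symm (AlgHom.congr_fun h a)
  · have h : (counit k).comp (sigmaHom k s μ) = counit k := by
      apply hom_ext <;> simp
    exact AlgHom.congr_fun h a
  · induction u using TensorProduct.induction_on with
    | zero => simp
    | add u v hu hv => simp only [map_add, hu, hv]
    | tmul a b =>
      induction a using DirectSum.Decomposition.inductionOn (homog k) with
      | zero => simp
      | add a a' h h' => simp only [TensorProduct.add_tmul, map_add, h, h']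
      | @homogeneous n a =>
        rw [TensorProduct.map_tmul, c, braiding_tmul _ _ a.2, TensorProduct.map_tmul]
        refine (braiding_tmul _ _ (sigma_mem_homog s μ a.2) _).trans ?_
        exact congrArg (· ⊗ₜ[k] _) (action_pow_sigma s μ n b)

theorem map_superPart_le {σ : Plane k ≃ₐ[k] Plane k} (hσ : σ ∈ G k) (i : ZMod 2) :
    (superPart k i).map σ.toLinearMap ≤ superPart k i := by
  obtain ⟨s, μ, rfl⟩ := hσ
  rw [superPart, Submodule.map_iSup]
  refine iSup_le fun n => ?_
  rw [Submodule.map_iSup]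
  refine iSup_le fun hn => le_iSup₂_of_le n hn ?_
  rintro _ ⟨a, ha, rfl⟩
  exact sigma_mem_homog s μ ha

theorem G_le_autSuper : G k ≤ autSuper k := by
  intro σ hσ i
  refine le_antisymm (map_superPart_le hσ i) fun a ha => ?_
  exact ⟨σ⁻¹ a, map_superPart_le (inv_mem hσ) i (Submodule.mem_map_of_mem ha),
    σ.apply_symm_apply a⟩

theorem G_le_autHopf : G k ≤ autHopf k := by
  rintro _ ⟨s, μ, rfl⟩
  exact sigma_mem_autHopf s μ

end Automorphisms

end SuperJordan

end

theorem mainTheorem5 (k : Type*) [Field k] (hk : ringChar k ≠ 2) :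
    SuperJordan.autHopf k ⊓ SuperJordan.autSuper k = SuperJordan.G k ∧
      (ringChar k = 0 → SuperJordan.autHopf k = SuperJordan.G k) := by
  refine ⟨le_antisymm SuperJordan.autHopf_inf_autSuper_le
    (le_inf SuperJordan.G_le_autHopf SuperJordan.G_le_autSuper), fun h0 => ?_⟩
  have : CharP k 0 := h0 ▸ ringChar.charP k
  have : CharZero k := CharP.charP_to_charZero k
  refine le_antisymm (fun σ hσ => ?_) SuperJordan.G_le_autHopf
  exact SuperJordan.mem_G_of_mem_V
    (SuperJordan.mem_V_of_mem_autHopf hσ (SuperJordan.X_mem_V k))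
    (SuperJordan.mem_V_of_mem_autHopf hσ (SuperJordan.Y_mem_V k))
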